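/- Let $(\Omega,\mathcal A,\mu)$ be a probability space and let $\mathcal C\subset\mathcal A$ be a sub-$\sigma$-algebra. For $E\in\mathcal A$ write $\mathcal C_E=\{A\cap E: A\in\mathcal C\}$ and $\mathcal A_E=\{A\cap E: A\in\mathcal A\}$. Assume that $\mathcal C$ is $\mu$-coarser than $\mathcal A$, i.e. for every $E\in\mathcal A$ with $\mu(E)>0$ there exists $E_0\in\mathcal A$, $E_0\subset E$, such that $\mu(F\,\Delta\,E_0)>0$ for all $F\in\mathcal C_E$. Then for every integer $n\ge 1$ and every $f=(f_1,\dots,f_n)\in L^1(\Omega,\mathcal A,\mu)^n$, the countably additive vector measure $$G:\mathcal A\to L^1(\Omega,\mathcal C,\mu)^n,\qquad G(E)=\bigl(\mathbb E(f_1\chi_E\mid\mathcal C),\dots,\mathbb E(f_n\chi_E\mid\mathcal C)\bigr),$$ is Lyapunov: for every $E\in\mathcal A$ the set $G(\mathcal A_E)=\{G(A\cap E):A\in\mathcal A\}$ is convex and weakly compact in $L^1(\Omega,\mathcal C,\mu)^n$. -/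

import Mathlib

open MeasureTheory

/-- The trace `𝒞_E = {A ∩ E : A ∈ 𝒞}` of a `σ`-algebra `𝒞` on a set `E`. -/
def traceSets {Ω : Type*} (C : MeasurableSpace Ω) (E : Set Ω) : Set (Set Ω) :=
  {F | ∃ A : Set Ω, MeasurableSet[C] A ∧ F = A ∩ E}

/-- `𝒞` is `μ`-coarser than the ambient `σ`-algebra `𝒜`: every `E ∈ 𝒜` of positive measure has a
subset `E₀ ∈ 𝒜` with `μ (F ∆ E₀) > 0` for every `F` in the trace `𝒞_E`. -/
def IsMuCoarser {Ω : Type*} (C : MeasurableSpace Ω) [mA : MeasurableSpace Ω]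
    (μ : Measure Ω) : Prop :=
  ∀ E : Set Ω, MeasurableSet[mA] E → 0 < μ E →
    ∃ E₀ : Set Ω, MeasurableSet[mA] E₀ ∧ E₀ ⊆ E ∧
      ∀ F ∈ traceSets C E, 0 < μ (symmDiff F E₀)

/-- A countably additive vector measure `G` with values in a normed space `X` is Lyapunov if, for
every measurable `E`, the set `{G (A ∩ E) : A measurable}` is convex and weakly compact. -/
def IsLyapunov {Ω : Type*} [mA : MeasurableSpace Ω] {X : Type*} [NormedAddCommGroup X]
    [NormedSpace ℝ X] (G : VectorMeasure Ω X) : Prop :=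
  ∀ E : Set Ω, MeasurableSet[mA] E →
    Convex ℝ (G '' traceSets mA E) ∧ IsCompact (toWeakSpace ℝ X '' (G '' traceSets mA E))

section CondExpMeasure

variable {Ω : Type*} {C : MeasurableSpace Ω} [mA : MeasurableSpace Ω] {μ : Measure Ω}

/-- The conditional expectation `𝔼(f χ_E | 𝒞)`, as an element of `L¹(Ω, 𝒞, μ)`, for
`f ∈ L¹(Ω, 𝒜, μ)`. Here `μ.trim hC` is the restriction of `μ` to `𝒞`. -/
noncomputable def condExpIndicatorL1 (hC : C ≤ mA) (f : Lp ℝ 1 μ) (E : Set Ω) :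
    Lp ℝ 1 (μ.trim hC) :=
  Integrable.toL1 (μ[E.indicator f | C])
    (integrable_condExp.trim hC stronglyMeasurable_condExp)

theorem condExpIndicatorL1_union (hC : C ≤ mA) (f : Lp ℝ 1 μ) {E F : Set Ω}
    (hE : MeasurableSet[mA] E) (hF : MeasurableSet[mA] F) (h : Disjoint E F) :
    condExpIndicatorL1 hC f (E ∪ F) = condExpIndicatorL1 hC f E + condExpIndicatorL1 hC f F := by
  unfold condExpIndicatorL1
  rw [← Integrable.toL1_add, Integrable.toL1_eq_toL1_iff]
  refine StronglyMeasurable.ae_eq_trim_of_stronglyMeasurable hC stronglyMeasurable_condExp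
    (stronglyMeasurable_condExp.add stronglyMeasurable_condExp) ?_
  have hf : Integrable f μ := L1.integrable_coeFn f
  rw [Set.indicator_union_of_disjoint h]
  exact condExp_add (hf.indicator hE) (hf.indicator hF) C

theorem norm_condExpIndicatorL1_le (hC : C ≤ mA) (f : Lp ℝ 1 μ) {E : Set Ω}
    (hE : MeasurableSet[mA] E) : ‖condExpIndicatorL1 hC f E‖ ≤ ∫ x in E, |f x| ∂μ := by
  have h1 : ‖condExpIndicatorL1 hC f E‖ = ∫ x, |(μ[E.indicator f | C]) x| ∂μ := by
    simp only [← Real.norm_eq_abs]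
    rw [L1.norm_eq_integral_norm,
      integral_trim hC (f := fun x => ‖(μ[E.indicator f | C]) x‖)
        stronglyMeasurable_condExp.norm]
    refine integral_congr_ae ?_
    filter_upwards [Integrable.coeFn_toL1
      (integrable_condExp.trim hC (stronglyMeasurable_condExp (μ := μ) (f := E.indicator f)))]
      with x hx
    rw [condExpIndicatorL1, hx]
  rw [h1]
  refine (integral_abs_condExp_le _).trans_eq ?_
  rw [← integral_indicator hE]
  congr 1
  ext x
  by_cases hx : x ∈ E <;> simp [hx]

theorem condExpIndicatorL1_empty (hC : C ≤ mA) (f : Lp ℝ 1 μ) :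
    condExpIndicatorL1 hC f ∅ = 0 := by
  have := norm_condExpIndicatorL1_le hC f (E := ∅) MeasurableSet.empty
  simpa using this

theorem hasSum_condExpIndicatorL1 (hC : C ≤ mA) (f : Lp ℝ 1 μ) {A : ℕ → Set Ω}
    (hA : ∀ i, MeasurableSet[mA] (A i)) (hd : Pairwise (Function.onFun Disjoint A)) :
    HasSum (fun i => condExpIndicatorL1 hC f (A i)) (condExpIndicatorL1 hC f (⋃ i, A i)) := by
  have hf : Integrable (fun x => |f x|) μ := (L1.integrable_coeFn f).abs
  have hfin : ∀ s : Finset ℕ, MeasurableSet[mA] (⋃ i ∈ s, A i) := fun s =>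
    s.measurableSet_biUnion fun i _ => hA i
  have hsum : ∀ s : Finset ℕ, condExpIndicatorL1 hC f (⋃ i ∈ s, A i) =
      ∑ i ∈ s, condExpIndicatorL1 hC f (A i) := by
    intro s
    induction s using Finset.induction_on with
    | empty => simpa using condExpIndicatorL1_empty hC f
    | insert a s ha ih =>
      rw [Finset.set_biUnion_insert, condExpIndicatorL1_union hC f (hA a) (hfin s), ih,
        Finset.sum_insert ha]
      rw [Set.disjoint_iUnion₂_right]
      exact fun i hi => hd fun h => ha (h ▸ hi)
  have hlim := hasSum_integral_iUnion hA hd hf.integrableOn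
  have hsub : ∀ s : Finset ℕ, (⋃ i ∈ s, A i) ⊆ ⋃ i, A i := fun s =>
    Set.iUnion₂_subset fun i _ => Set.subset_iUnion A i
  rw [HasSum] at hlim ⊢
  rw [tendsto_iff_norm_sub_tendsto_zero] at hlim ⊢
  refine squeeze_zero (fun _ => norm_nonneg _) (fun s => ?_) hlim
  have hdiff : MeasurableSet[mA] ((⋃ i, A i) \ ⋃ i ∈ s, A i) :=
    (MeasurableSet.iUnion hA).diff (hfin s)
  have h2 : condExpIndicatorL1 hC f (⋃ i, A i) = condExpIndicatorL1 hC f (⋃ i ∈ s, A i) +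
      condExpIndicatorL1 hC f ((⋃ i, A i) \ ⋃ i ∈ s, A i) := by
    rw [← condExpIndicatorL1_union hC f (hfin s) hdiff Set.disjoint_sdiff_right,
      Set.union_sdiff_cancel (hsub s)]
  rw [← hsum, h2, sub_add_cancel_left, norm_neg, ← integral_biUnion_finset s (fun i _ => hA i)
    (fun i _ j _ hij => hd hij) (fun i _ => hf.integrableOn), Real.norm_eq_abs, abs_sub_comm,
    ← setIntegral_sdiff (hfin s) hf.integrableOn (hsub s)]
  exact (norm_condExpIndicatorL1_le hC f hdiff).trans (le_abs_self _)

open Classical in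
/-- The vector measure `E ↦ (𝔼(f₁ χ_E | 𝒞), …, 𝔼(fₙ χ_E | 𝒞))` on `𝒜`, with values in
`L¹(Ω, 𝒞, μ)ⁿ`, for `f = (f₁, …, fₙ) ∈ L¹(Ω, 𝒜, μ)ⁿ`. -/
noncomputable def condExpVectorMeasure (hC : C ≤ mA) {n : ℕ} (f : Fin n → Lp ℝ 1 μ) :
    VectorMeasure Ω (Fin n → Lp ℝ 1 (μ.trim hC)) where
  measureOf' E := if MeasurableSet[mA] E then fun i => condExpIndicatorL1 hC (f i) E else 0
  empty' := by
    rw [if_pos MeasurableSet.empty]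
    exact funext fun i => condExpIndicatorL1_empty hC (f i)
  not_measurable' E hE := if_neg hE
  m_iUnion' A hA hd := by
    rw [if_pos (MeasurableSet.iUnion hA)]
    simp only [if_pos (hA _)]
    exact Pi.hasSum.2 fun i => hasSum_condExpIndicatorL1 hC (f i) hA hd

end CondExpMeasure

/-!
The proof follows Lindenstrauss's argument for Lyapunov's convexity theorem: the values of the
vector measure are compared with those of a linear operator on an order interval of functions,
and the extreme points of its fibres turn out to be truncations `w χ_B` of a fixed weight `w`.

To stay inside a Hilbert space, write `fᵢ = kᵢ w` with `kᵢ` and `w > 0` in `L²`, for example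
`w = √(1 + ∑ |fᵢ|)` (`exists_common_memLp_two_factor`). The operator
`T u = (𝔼(k₁ u | 𝒞), …, 𝔼(kₙ u | 𝒞))` is continuous from `L²` to `L¹(𝒞)ⁿ` by Hölder's inequality,
hence weakly continuous, and `G(B) = T (w χ_B)`. The order interval `[0, w χ_E]` is convex, closed
and bounded in `L²`, so it is weakly compact, and its image under `T` is convex and weakly compact.
It remains to see that this image is exactly `G(𝒜_E)`
(`image_condExpVectorMeasure_traceSets`). Each nonempty fibre of `T` over the interval has an
extreme point `u` by the Krein–Milman theorem, and `u` takes only the values `0` and `w χ_E`: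
otherwise `0 < u < w χ_E` on a set `F` of positive measure, and with
`δ = min (u, w χ_E - u)` there is a function `h` on `F`, `|h| ≤ 1`, not almost everywhere zero,
with `𝔼(kᵢ δ h | 𝒞) = 0` for all `i`, so that `u` is the midpoint of the points `u ± δ h` of the
fibre.

The existence of `h` is where the hypothesis on `𝒞` enters
(`IsMuCoarser.exists_ne_zero_condExp_mul_eq_zero`). It goes by induction on the number of
functions: `F` contains two disjoint sets which are charged by common `𝒞`-measurable sets, each
carries a solution `hⱼ` for the first `n` functions, and a combination `c₁ h₁ + c₂ h₂` with
`𝒞`-measurable bounded coefficients solves the remaining equation while keeping the others, since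
`𝒞`-measurable factors can be pulled out of the conditional expectation.
-/

/-! ### Weak compactness in Hilbert space -/

/-- The Riesz identification of the dual of a Hilbert space with the space itself is continuous
from the weak-* to the weak topology. -/
theorem continuous_toWeakSpace_toDual_symm (H : Type*) [NormedAddCommGroup H]
    [InnerProductSpace ℝ H] [CompleteSpace H] :
    Continuous fun φ : WeakDual ℝ H =>
      toWeakSpace ℝ H ((InnerProductSpace.toDual ℝ H).symm (WeakDual.toStrongDual φ)) := by
  refine WeakBilin.continuous_of_continuous_eval _ fun ψ => ?_
  have h := WeakDual.eval_continuous (𝕜 := ℝ) ((InnerProductSpace.toDual ℝ H).symm ψ)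
  refine h.congr fun φ => ?_
  change _ = ψ ((InnerProductSpace.toDual ℝ H).symm (WeakDual.toStrongDual φ))
  rw [← InnerProductSpace.toDual_symm_apply (y := ψ), real_inner_comm,
    InnerProductSpace.toDual_symm_apply]
  rfl

/-- By the Banach–Alaoglu theorem and reflexivity, closed bounded convex sets in a Hilbert space
are weakly compact. -/
theorem isCompact_toWeakSpace_image {H : Type*} [NormedAddCommGroup H]
    [InnerProductSpace ℝ H] [CompleteSpace H] {K : Set H} (hc : Convex ℝ K) (hcl : IsClosed K)
    (hb : Bornology.IsBounded K) : IsCompact (toWeakSpace ℝ H '' K) := by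
  obtain ⟨r, hr⟩ := hb.subset_closedBall 0
  have h1 := (WeakDual.isCompact_closedBall (𝕜 := ℝ) (0 : StrongDual ℝ H) r).image
    (continuous_toWeakSpace_toDual_symm H)
  refine h1.of_isClosed_subset ?_ ?_
  · have := hc.toWeakSpace_closure ℝ
    rw [hcl.closure_eq] at this
    rw [this]
    exact isClosed_closure
  · rintro _ ⟨x, hx, rfl⟩
    refine ⟨StrongDual.toWeakDual (InnerProductSpace.toDual ℝ H x), ?_, by simp⟩
    simpa using hr hx

/-- The Krein–Milman theorem in the weak topology. -/
theorem extremePoints_nonempty_of_isClosed {H : Type*} [NormedAddCommGroup H]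
    [InnerProductSpace ℝ H] [CompleteSpace H] {K : Set H} (hc : Convex ℝ K) (hcl : IsClosed K)
    (hb : Bornology.IsBounded K) (hne : K.Nonempty) : (K.extremePoints ℝ).Nonempty := by
  have : LocallyConvexSpace ℝ (WeakSpace ℝ H) := WeakBilin.locallyConvexSpace
  obtain ⟨x, hx⟩ := (isCompact_toWeakSpace_image hc hcl hb).extremePoints_nonempty
    (hne.image _)
  rw [← image_extremePoints] at hx
  obtain ⟨y, hy, -⟩ := hx
  exact ⟨y, hy⟩

/-! ### Order intervals in `L²` -/

theorem convex_Icc_Lp_two {Ω : Type*} [MeasurableSpace Ω] {μ : Measure Ω} (v w : Lp ℝ 2 μ) :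
    Convex ℝ (Set.Icc v w) := by
  have : PosSMulMono ℝ (Lp ℝ 2 μ) := ⟨fun a ha u v huv => by
    rw [← Lp.coeFn_le] at huv ⊢
    filter_upwards [huv, Lp.coeFn_smul a u, Lp.coeFn_smul a v] with x h hu hv
    rw [hu, hv]
    exact mul_le_mul_of_nonneg_left h ha⟩
  exact convex_Icc _ _

theorem isBounded_Icc_zero_Lp_two {Ω : Type*} [MeasurableSpace Ω] {μ : Measure Ω}
    (w : Lp ℝ 2 μ) : Bornology.IsBounded (Set.Icc 0 w) := by
  refine (Metric.isBounded_closedBall (x := 0) (r := ‖w‖)).subset fun u hu => ?_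
  simpa using norm_le_norm_of_abs_le_abs (abs_le_abs_of_nonneg hu.1 hu.2)

/-! ### Functions annihilated by finitely many conditional expectations -/

section Perturbation

variable {Ω : Type*} {C : MeasurableSpace Ω} [mA : MeasurableSpace Ω] {μ : Measure Ω}

/-- A nonnegative integrable function lives on the `C`-measurable set where its conditional
expectation is positive. -/
theorem ae_pos_condExp_of_ne_zero [IsFiniteMeasure μ] (hC : C ≤ mA) {g : Ω → ℝ}
    (hg : Integrable g μ) (hg0 : 0 ≤ g) : ∀ᵐ x ∂μ, g x ≠ 0 → 0 < (μ[g | C]) x := by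
  have hS : MeasurableSet[C] {x | (μ[g | C]) x ≤ 0} :=
    (stronglyMeasurable_condExp (μ := μ) (f := g)).measurable measurableSet_Iic
  have h1 : ∫ x in {x | (μ[g | C]) x ≤ 0}, g x ∂μ = 0 := by
    refine le_antisymm ?_ (integral_nonneg hg0)
    rw [← setIntegral_condExp hC hg hS]
    exact setIntegral_nonpos (hC _ hS) fun x hx => hx
  rw [setIntegral_eq_zero_iff_of_nonneg_ae (Filter.Eventually.of_forall hg0) hg.integrableOn,
    Filter.EventuallyEq, ae_restrict_iff' (hC _ hS)] at h1
  filter_upwards [h1] with x hx hne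
  by_contra! h
  exact hne (hx h)

/-- Conditional expectation is local with respect to `C`-measurable sets. -/
theorem condExp_ae_eq_zero_of_ae_eq_zero_on (hC : C ≤ mA) {g : Ω → ℝ} {N : Set Ω}
    (hN : MeasurableSet[C] N) (h : ∀ᵐ x ∂μ, x ∈ N → g x = 0) :
    ∀ᵐ x ∂μ, x ∈ N → (μ[g | C]) x = 0 := by
  have h1 : g =ᵐ[μ.restrict N] 0 := (ae_restrict_iff' (hC _ hN)).2 h
  exact (ae_restrict_iff' (hC _ hN)).1 (condExp_ae_eq_restrict_zero hN h1)

/-- If `C` is `μ`-coarser, every set of positive measure contains two disjoint subsets, the first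
of positive measure, such that every `C`-measurable set charging the first charges the second. -/
theorem IsMuCoarser.exists_disjoint_subsets [IsFiniteMeasure μ] (hC : C ≤ mA)
    (h : IsMuCoarser C μ) {F : Set Ω} (hF : MeasurableSet F) (hF0 : 0 < μ F) :
    ∃ F₁ F₂ : Set Ω, MeasurableSet F₁ ∧ MeasurableSet F₂ ∧ F₁ ⊆ F ∧ F₂ ⊆ F ∧ Disjoint F₁ F₂ ∧
      0 < μ F₁ ∧ ∀ N, MeasurableSet[C] N → 0 < μ (F₁ ∩ N) → 0 < μ (F₂ ∩ N) := by
  obtain ⟨E₀, hE₀, hE₀F, hE⟩ := h F hF hF0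
  set g : Ω → ℝ := (F \ E₀).indicator 1 with hg
  have hgi : Integrable g μ := (integrable_const (1 : ℝ)).indicator (hF.diff hE₀)
  have hg0 : 0 ≤ g := Set.indicator_nonneg fun _ _ => zero_le_one
  have hS : MeasurableSet[C] {x | 0 < (μ[g | C]) x} :=
    stronglyMeasurable_condExp.measurable measurableSet_Ioi
  refine ⟨E₀ ∩ {x | 0 < (μ[g | C]) x}, F \ E₀, hE₀.inter (hC _ hS), hF.diff hE₀,
    Set.inter_subset_left.trans hE₀F, Set.sdiff_subset,
    Set.disjoint_sdiff_right.mono_left Set.inter_subset_left, ?_, ?_⟩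
  -- otherwise `E₀` would be the trace on `F` of the set where the conditional probability
  -- of `F \ E₀` vanishes
  · refine (hE _ ⟨_, hS.compl, rfl⟩).trans_le (measure_mono_ae ?_)
    filter_upwards [ae_pos_condExp_of_ne_zero hC hgi hg0] with x hx hxs
    rcases hxs with ⟨⟨h1, h2⟩, h3⟩ | ⟨h1, h2⟩
    · exact absurd (hx (by simp [hg, h2, h3])) h1
    · refine ⟨h1, ?_⟩
      by_contra h3
      exact h2 ⟨h3, hE₀F h1⟩
  · intro N hN hpos
    by_contra hzero
    rw [not_lt, nonpos_iff_eq_zero] at hzero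
    refine hpos.ne' (measure_eq_zero_iff_ae_notMem.2 ?_)
    have h1 : ∀ᵐ x ∂μ, x ∈ N → g x = 0 := by
      filter_upwards [measure_eq_zero_iff_ae_notMem.1 hzero] with x hx hxN
      exact Set.indicator_of_notMem (fun h => hx ⟨h, hxN⟩) _
    filter_upwards [condExp_ae_eq_zero_of_ae_eq_zero_on hC hN h1] with x hx hxm
    exact hxm.1.2.ne' (hx hxm.2)

/-- The algebraic core: on every set of positive measure there is a nonzero bounded function
whose products with `n` given integrable functions have zero conditional expectation. Given such
functions `h₁, h₂` for the first `n` functions, with disjoint supports, the combination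
`𝔼(f h₂ | C) h₁ - 𝔼(f h₁ | C) h₂` is also annihilated by the last function `f`. -/
theorem IsMuCoarser.exists_ne_zero_condExp_mul_eq_zero [IsFiniteMeasure μ] (hC : C ≤ mA)
    (hcoarse : IsMuCoarser C μ) (n : ℕ) (f : Fin n → Ω → ℝ) (hf : ∀ i, Integrable (f i) μ)
    {F : Set Ω} (hF : MeasurableSet F) (hF0 : 0 < μ F) :
    ∃ h : Ω → ℝ, Measurable h ∧ (∀ x, |h x| ≤ 1) ∧ (∀ x, x ∉ F → h x = 0) ∧
      ¬ h =ᵐ[μ] 0 ∧ ∀ i, μ[f i * h | C] =ᵐ[μ] 0 := by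
  induction n generalizing F with
  | zero =>
    refine ⟨F.indicator 1, measurable_one.indicator hF, fun x => ?_, fun x hx => by simp [hx],
      fun h => hF0.ne' ?_, fun i => i.elim0⟩
    · by_cases hx : x ∈ F <;> simp [hx]
    · rw [measure_eq_zero_iff_ae_notMem]
      filter_upwards [h] with x hx hxF
      simp [hxF] at hx
  | succ n ih =>
    obtain ⟨F₁, F₂, hF₁, hF₂, hF₁F, hF₂F, hdisj, hpos, hN⟩ :=
      hcoarse.exists_disjoint_subsets hC hF hF0
    obtain ⟨h₁, h₁m, h₁b, h₁s, h₁0, h₁f⟩ :=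
      ih (fun i => f i.castSucc) (fun i => hf _) hF₁ hpos
    have habs : Integrable (fun x => |h₁ x|) μ :=
      Integrable.of_bound h₁m.abs.aestronglyMeasurable 1
        (Filter.Eventually.of_forall fun x => by simpa using h₁b x)
    set S : Set Ω := {x | 0 < (μ[fun x => |h₁ x| | C]) x}
    have hS : MeasurableSet[C] S := stronglyMeasurable_condExp.measurable measurableSet_Ioi
    have hF₁S : 0 < μ (F₁ ∩ S) := by
      rw [pos_iff_ne_zero]
      intro h0
      refine h₁0 ?_
      filter_upwards [measure_eq_zero_iff_ae_notMem.1 h0,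
        ae_pos_condExp_of_ne_zero hC habs fun x => abs_nonneg _] with x hx hx'
      by_contra hne
      exact hx ⟨by_contra fun h => hne (h₁s x h), hx' (abs_ne_zero.2 hne)⟩
    -- `h₂` is taken inside `S`, so that a `C`-measurable set off which `h₁` vanishes contains `S`
    -- and thereby the support of `h₂`, up to null sets
    obtain ⟨h₂, h₂m, h₂b, h₂s, h₂0, h₂f⟩ :=
      ih (fun i => f i.castSucc) (fun i => hf _) (hF₂.inter (hC _ hS)) (hN S hS hF₁S)
    have hi₁ : ∀ i, Integrable (f i * h₁) μ := fun i =>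
      (hf i).mul_bdd (c := 1) h₁m.aestronglyMeasurable (Filter.Eventually.of_forall h₁b)
    have hi₂ : ∀ i, Integrable (f i * h₂) μ := fun i =>
      (hf i).mul_bdd (c := 1) h₂m.aestronglyMeasurable (Filter.Eventually.of_forall h₂b)
    set a₁ : Ω → ℝ := μ[f (Fin.last n) * h₂ | C]
    set a₂ : Ω → ℝ := μ[f (Fin.last n) * h₁ | C]
    have ha₁ : StronglyMeasurable[C] a₁ := stronglyMeasurable_condExp
    have ha₂ : StronglyMeasurable[C] a₂ := stronglyMeasurable_condExp
    by_cases hz : a₁ * h₁ =ᵐ[μ] 0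
    -- `h₁ = 0` on `{a₁ ≠ 0}`, so this set does not meet `S`, and `h₂ = 0` off `S`
    · refine ⟨h₂, h₂m, h₂b, fun x hx => h₂s x fun h => hx (hF₂F h.1), h₂0,
        Fin.lastCases ?_ h₂f⟩
      have hN1 : MeasurableSet[C] {x | a₁ x ≠ 0} :=
        ha₁.measurable (measurableSet_singleton 0).compl
      have e1 := condExp_ae_eq_zero_of_ae_eq_zero_on (μ := μ) (g := fun x => |h₁ x|) hC hN1 (by
        filter_upwards [hz] with x hx hxa
        exact abs_eq_zero.2 ((mul_eq_zero.1 hx).resolve_left hxa))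
      have e2 := condExp_ae_eq_zero_of_ae_eq_zero_on (μ := μ) (g := f (Fin.last n) * h₂) hC
        hS.compl (Filter.Eventually.of_forall fun x hx => by
          simp [h₂s x fun h => hx h.2])
      filter_upwards [e1, e2] with x hx1 hx2
      by_contra hne
      exact hne (hx2 fun hxS => (hx1 hne).not_gt hxS)
    -- the coefficients are divided by `D` to make them bounded
    · set D : Ω → ℝ := fun x => 1 + |a₁ x| + |a₂ x| with hD
      have hD0 : ∀ x, 0 < D x := fun x => by positivity
      have hDm : StronglyMeasurable[C] D :=
        (stronglyMeasurable_const.add ha₁.norm).add ha₂.norm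
      set c₁ : Ω → ℝ := fun x => a₁ x / D x with hc₁
      set c₂ : Ω → ℝ := fun x => a₂ x / D x with hc₂
      have hc₁m : StronglyMeasurable[C] c₁ := ha₁.div₀ hDm fun x => (hD0 x).ne'
      have hc₂m : StronglyMeasurable[C] c₂ := ha₂.div₀ hDm fun x => (hD0 x).ne'
      have hc₁b : ∀ x, |c₁ x| ≤ 1 := fun x => by
        rw [hc₁, abs_div, abs_of_pos (hD0 x), div_le_one (hD0 x)]
        simp only [hD]; linarith [abs_nonneg (a₂ x)]
      have hc₂b : ∀ x, |c₂ x| ≤ 1 := fun x => by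
        rw [hc₂, abs_div, abs_of_pos (hD0 x), div_le_one (hD0 x)]
        simp only [hD]; linarith [abs_nonneg (a₁ x)]
      have key : ∀ i, μ[f i * (c₁ * h₁ - c₂ * h₂) | C] =ᵐ[μ]
          c₁ * μ[f i * h₁ | C] - c₂ * μ[f i * h₂ | C] := by
        intro i
        have e : f i * (c₁ * h₁ - c₂ * h₂) = c₁ * (f i * h₁) - c₂ * (f i * h₂) := by ring
        rw [e]
        have p₁ := condExp_stronglyMeasurable_mul_of_bound hC hc₁m (hi₁ i) 1
          (Filter.Eventually.of_forall hc₁b)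
        have p₂ := condExp_stronglyMeasurable_mul_of_bound hC hc₂m (hi₂ i) 1
          (Filter.Eventually.of_forall hc₂b)
        refine (condExp_sub ?_ ?_ C).trans (p₁.sub p₂)
        · exact (hi₁ i).bdd_mul (c := 1) (hc₁m.mono hC).aestronglyMeasurable
            (Filter.Eventually.of_forall hc₁b)
        · exact (hi₂ i).bdd_mul (c := 1) (hc₂m.mono hC).aestronglyMeasurable
            (Filter.Eventually.of_forall hc₂b)
      have hs2 : ∀ x, x ∉ F₂ → h₂ x = 0 := fun x hx => h₂s x fun h => hx h.1
      have hs12 : ∀ x, h₁ x ≠ 0 → h₂ x = 0 := fun x hx => hs2 x fun h =>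
        Set.disjoint_left.1 hdisj (by_contra fun h' => hx (h₁s x h')) h
      refine ⟨c₁ * h₁ - c₂ * h₂, ((hc₁m.mono hC).measurable.mul h₁m).sub
        ((hc₂m.mono hC).measurable.mul h₂m), fun x => ?_, fun x hx => ?_, fun h0 => hz ?_,
        Fin.lastCases ?_ fun i => ?_⟩
      · by_cases hx : h₁ x = 0
        · simpa [hx, abs_mul] using mul_le_one₀ (hc₂b x) (abs_nonneg _) (h₂b x)
        · simpa [hs12 x hx, abs_mul] using mul_le_one₀ (hc₁b x) (abs_nonneg _) (h₁b x)
      · simp [h₁s x fun h => hx (hF₁F h), hs2 x fun h => hx (hF₂F h)]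
      · filter_upwards [h0] with x hx
        by_cases hx1 : h₁ x = 0
        · simp [hx1]
        · simpa [hs12 x hx1, hx1, hc₁, (hD0 x).ne'] using hx
      · refine (key _).trans (Filter.Eventually.of_forall fun x => ?_)
        change a₁ x / D x * a₂ x - a₂ x / D x * a₁ x = 0
        ring
      · filter_upwards [key i.castSucc, h₁f i, h₂f i] with x hx e₁ e₂
        rw [hx]
        simp [e₁, e₂]

end Perturbation

/-! ### Conditional expectation against square-integrable weights -/

section WeightedCondExp

variable {Ω : Type*} {C : MeasurableSpace Ω} [mA : MeasurableSpace Ω] {μ : Measure Ω}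

/-- The conditional expectation as a contraction from `L¹(Ω, 𝒜, μ)` to `L¹(Ω, 𝒞, μ)`; it is
expressed through `condExpIndicatorL1` on the whole space. -/
noncomputable def condExpTrimCLM (hC : C ≤ mA) : Lp ℝ 1 μ →L[ℝ] Lp ℝ 1 (μ.trim hC) :=
  LinearMap.mkContinuous
    { toFun := fun g => condExpIndicatorL1 hC g Set.univ
      map_add' := fun g g' => by
        simp only [condExpIndicatorL1, Set.indicator_univ]
        rw [← Integrable.toL1_add, Integrable.toL1_eq_toL1_iff]
        refine StronglyMeasurable.ae_eq_trim_of_stronglyMeasurable hC stronglyMeasurable_condExp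
          (stronglyMeasurable_condExp.add stronglyMeasurable_condExp) ?_
        exact (condExp_congr_ae (Lp.coeFn_add g g')).trans
          (condExp_add (L1.integrable_coeFn g) (L1.integrable_coeFn g') C)
      map_smul' := fun c g => by
        simp only [condExpIndicatorL1, Set.indicator_univ]
        rw [RingHom.id_apply, ← Integrable.toL1_smul, Integrable.toL1_eq_toL1_iff]
        refine StronglyMeasurable.ae_eq_trim_of_stronglyMeasurable hC stronglyMeasurable_condExp
          (stronglyMeasurable_condExp.const_smul c) ?_
        exact (condExp_congr_ae (Lp.coeFn_smul c g)).trans (condExp_smul c g C) }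
    1 fun g => by
      refine (norm_condExpIndicatorL1_le hC g MeasurableSet.univ).trans_eq ?_
      rw [one_mul, L1.norm_eq_integral_norm, setIntegral_univ]
      rfl

theorem condExpTrimCLM_eq_condExpIndicatorL1 (hC : C ≤ mA) {g f : Lp ℝ 1 μ} {B : Set Ω}
    (h : g =ᵐ[μ] B.indicator f) : condExpTrimCLM hC g = condExpIndicatorL1 hC f B := by
  change condExpIndicatorL1 hC g Set.univ = _
  simp only [condExpIndicatorL1, Set.indicator_univ]
  rw [Integrable.toL1_eq_toL1_iff]
  exact StronglyMeasurable.ae_eq_trim_of_stronglyMeasurable hC stronglyMeasurable_condExp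
    stronglyMeasurable_condExp (condExp_congr_ae h)

theorem condExpTrimCLM_eq_zero (hC : C ≤ mA) {g : Lp ℝ 1 μ} (h : μ[g | C] =ᵐ[μ] 0) :
    condExpTrimCLM hC g = 0 := by
  change condExpIndicatorL1 hC g Set.univ = _
  simp only [condExpIndicatorL1, Set.indicator_univ]
  rw [← Integrable.toL1_zero (integrable_zero Ω ℝ _), Integrable.toL1_eq_toL1_iff]
  exact StronglyMeasurable.ae_eq_trim_of_stronglyMeasurable hC stronglyMeasurable_condExp
    stronglyMeasurable_zero h

/-- The operator `u ↦ (𝔼(k₁ u | 𝒞), …, 𝔼(kₙ u | 𝒞))` from `L²(Ω, 𝒜, μ)` to `L¹(Ω, 𝒞, μ)ⁿ`, for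
weights `kᵢ` in `L²(Ω, 𝒜, μ)`. -/
noncomputable def weightedCondExpCLM (hC : C ≤ mA) {n : ℕ} (k : Fin n → Lp ℝ 2 μ) :
    Lp ℝ 2 μ →L[ℝ] (Fin n → Lp ℝ 1 (μ.trim hC)) :=
  ContinuousLinearMap.pi fun i =>
    (condExpTrimCLM hC).comp ((ContinuousLinearMap.mul ℝ ℝ).holderL μ 2 2 1 (k i))

theorem weightedCondExpCLM_apply (hC : C ≤ mA) {n : ℕ} (k : Fin n → Lp ℝ 2 μ) (u : Lp ℝ 2 μ)
    (i : Fin n) : weightedCondExpCLM hC k u i =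
      condExpTrimCLM hC ((ContinuousLinearMap.mul ℝ ℝ).holder 1 (k i) u) := rfl

/-- An extreme point of a fibre of the operator over the order interval `[0, w]` takes only the
values `0` and `w`: where it does not, it can be moved in both directions along the fibre. -/
theorem ae_eq_zero_or_eq_of_mem_extremePoints [IsFiniteMeasure μ] (hC : C ≤ mA)
    (hcoarse : IsMuCoarser C μ) {n : ℕ} (k : Fin n → Lp ℝ 2 μ) (w : Lp ℝ 2 μ)
    (y : Fin n → Lp ℝ 1 (μ.trim hC)) {u : Lp ℝ 2 μ}
    (hu : u ∈ (Set.Icc 0 w ∩ weightedCondExpCLM hC k ⁻¹' {y}).extremePoints ℝ) :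
    ∀ᵐ x ∂μ, u x = 0 ∨ u x = w x := by
  obtain ⟨⟨⟨hu0, huw⟩, hy⟩, hext⟩ := hu
  have hu0' : ∀ᵐ x ∂μ, 0 ≤ u x := (Lp.coeFn_nonneg u).2 hu0
  have huw' : ∀ᵐ x ∂μ, u x ≤ w x := (Lp.coeFn_le u w).2 huw
  set F : Set Ω := {x | 0 < u x ∧ u x < w x}
  have hF : MeasurableSet F :=
    (measurableSet_lt measurable_const (Lp.stronglyMeasurable u).measurable).inter
      (measurableSet_lt (Lp.stronglyMeasurable u).measurable
        (Lp.stronglyMeasurable w).measurable)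
  have hF0 : μ F = 0 := by
    by_contra hne
    set δ : Ω → ℝ := fun x => min (u x) (w x - u x) with hδ
    have hδL : MemLp δ 2 μ := (Lp.memLp u).inf ((Lp.memLp w).sub (Lp.memLp u))
    obtain ⟨h, hm, hb, hs, h0, hh⟩ := hcoarse.exists_ne_zero_condExp_mul_eq_zero hC n
      (fun i => k i * δ) (fun i => (Lp.memLp (k i)).integrable_mul hδL) hF
      (pos_iff_ne_zero.2 hne)
    have hδh : MemLp (δ * h) 2 μ := by
      refine hδL.mono (hδL.1.mul hm.aestronglyMeasurable) (Filter.Eventually.of_forall fun x => ?_)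
      rw [Pi.mul_apply, norm_mul]
      exact mul_le_of_le_one_right (norm_nonneg _) (hb x)
    set d : Lp ℝ 2 μ := hδh.toLp
    have hd : d =ᵐ[μ] δ * h := hδh.coeFn_toLp
    have hT : weightedCondExpCLM hC k d = 0 := by
      funext i
      rw [weightedCondExpCLM_apply]
      refine condExpTrimCLM_eq_zero hC ((condExp_congr_ae ?_).trans (hh i))
      filter_upwards [(ContinuousLinearMap.mul ℝ ℝ).coeFn_holder (r := 1) (k i) d, hd]
        with x h1 h2
      rw [h1, h2]
      simp [mul_assoc]
    have hbound : ∀ᵐ x ∂μ, |d x| ≤ u x ∧ |d x| ≤ w x - u x := by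
      filter_upwards [hd, hu0', huw'] with x h1 h2 h3
      have hδ0 : 0 ≤ δ x := le_min h2 (sub_nonneg.2 h3)
      have : |d x| ≤ δ x := by
        rw [h1, Pi.mul_apply, abs_mul, abs_of_nonneg hδ0]
        exact mul_le_of_le_one_right hδ0 (hb x)
      exact ⟨this.trans (min_le_left _ _), this.trans (min_le_right _ _)⟩
    have hplus : u + d ∈ Set.Icc 0 w ∩ weightedCondExpCLM hC k ⁻¹' {y} := by
      refine ⟨⟨(Lp.coeFn_nonneg _).1 ?_, (Lp.coeFn_le _ _).1 ?_⟩, ?_⟩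
      · filter_upwards [hbound, Lp.coeFn_add u d] with x h1 h2
        rw [h2, Pi.add_apply, Pi.zero_apply]
        linarith [neg_abs_le (d x)]
      · filter_upwards [hbound, Lp.coeFn_add u d] with x h1 h2
        rw [h2, Pi.add_apply]
        linarith [le_abs_self (d x)]
      · rw [Set.mem_preimage, map_add, hT, add_zero]
        exact hy
    have hminus : u - d ∈ Set.Icc 0 w ∩ weightedCondExpCLM hC k ⁻¹' {y} := by
      refine ⟨⟨(Lp.coeFn_nonneg _).1 ?_, (Lp.coeFn_le _ _).1 ?_⟩, ?_⟩
      · filter_upwards [hbound, Lp.coeFn_sub u d] with x h1 h2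
        rw [h2, Pi.sub_apply, Pi.zero_apply]
        linarith [le_abs_self (d x)]
      · filter_upwards [hbound, Lp.coeFn_sub u d] with x h1 h2
        rw [h2, Pi.sub_apply]
        linarith [neg_abs_le (d x)]
      · rw [Set.mem_preimage, map_sub, hT, sub_zero]
        exact hy
    have hseg : u ∈ openSegment ℝ (u + d) (u - d) :=
      ⟨1 / 2, 1 / 2, by norm_num, by norm_num, by norm_num, by module⟩
    have hd0 : d = 0 := by simpa using hext hplus hminus hseg
    refine h0 ?_
    filter_upwards [hd, Lp.coeFn_zero ℝ 2 μ] with x h1 h2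
    by_contra hne
    have hxF : x ∈ F := by_contra fun hx => hne (hs x hx)
    have hpos : 0 < δ x := lt_min hxF.1 (sub_pos.2 hxF.2)
    rw [hd0, h2] at h1
    exact (mul_ne_zero hpos.ne' hne) h1.symm
  filter_upwards [measure_eq_zero_iff_ae_notMem.1 hF0, hu0', huw'] with x hx h1 h2
  by_contra! hne
  exact hx ⟨lt_of_le_of_ne h1 hne.1.symm, lt_of_le_of_ne h2 hne.2⟩

/-! ### The range of the vector measure -/

/-- If `fᵢ = kᵢ w`, the vector measure is the weighted conditional expectation of `w χ_B`. -/
theorem weightedCondExpCLM_eq_condExpVectorMeasure (hC : C ≤ mA) {n : ℕ} {k : Fin n → Lp ℝ 2 μ}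
    {f : Fin n → Lp ℝ 1 μ} {w : Ω → ℝ} (hkf : ∀ i, ∀ᵐ x ∂μ, k i x * w x = f i x)
    {B : Set Ω} (hB : MeasurableSet B) {u : Lp ℝ 2 μ} (hu : u =ᵐ[μ] B.indicator w) :
    weightedCondExpCLM hC k u = condExpVectorMeasure hC f B := by
  have e : condExpVectorMeasure hC f B = fun i => condExpIndicatorL1 hC (f i) B := if_pos hB
  rw [e]
  funext i
  rw [weightedCondExpCLM_apply]
  refine condExpTrimCLM_eq_condExpIndicatorL1 hC ?_
  filter_upwards [(ContinuousLinearMap.mul ℝ ℝ).coeFn_holder (r := 1) (k i) u, hu, hkf i]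
    with x h1 h2 h3
  rw [h1, h2]
  by_cases hx : x ∈ B <;> simp [hx, h3]

/-- Finitely many integrable functions are products of square-integrable ones with a common
positive square-integrable factor, namely `√(1 + ∑ |fᵢ|)`. -/
theorem exists_common_memLp_two_factor [IsFiniteMeasure μ] {n : ℕ} (f : Fin n → Lp ℝ 1 μ) :
    ∃ (w : Ω → ℝ) (k : Fin n → Lp ℝ 2 μ), MemLp w 2 μ ∧ (∀ x, 0 < w x) ∧
      ∀ i, ∀ᵐ x ∂μ, k i x * w x = f i x := by
  set s : Ω → ℝ := fun x => 1 + ∑ i, |f i x| with hs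
  have hsm : Measurable s := measurable_const.add (Finset.measurable_sum _ fun i _ =>
    (Lp.stronglyMeasurable (f i)).measurable.abs)
  have hsi : Integrable s μ :=
    (integrable_const 1).add (integrable_finsetSum _ fun i _ => (L1.integrable_coeFn (f i)).abs)
  have hs1 : ∀ x, 0 < s x := fun x => by positivity
  have hle : ∀ i x, |f i x| ≤ s x := fun i x =>
    (Finset.single_le_sum (f := fun i => |f i x|) (fun j _ => abs_nonneg _)
      (Finset.mem_univ i)).trans (by simp [hs])
  have hw : MemLp (fun x => √(s x)) 2 μ := by
    rw [memLp_two_iff_integrable_sq hsm.sqrt.aestronglyMeasurable]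
    exact hsi.congr (Filter.Eventually.of_forall fun x => (Real.sq_sqrt (hs1 x).le).symm)
  have hk : ∀ i, MemLp (fun x => f i x / √(s x)) 2 μ := fun i => by
    have hm : Measurable fun x => f i x / √(s x) :=
      (Lp.stronglyMeasurable (f i)).measurable.div hsm.sqrt
    rw [memLp_two_iff_integrable_sq hm.aestronglyMeasurable]
    refine (L1.integrable_coeFn (f i)).mono (hm.pow_const 2).aestronglyMeasurable
      (Filter.Eventually.of_forall fun x => ?_)
    rw [Real.norm_of_nonneg (sq_nonneg _), div_pow, Real.sq_sqrt (hs1 x).le, Real.norm_eq_abs,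
      div_le_iff₀ (hs1 x), ← sq_abs, sq]
    exact mul_le_mul_of_nonneg_left (hle i x) (abs_nonneg _)
  refine ⟨fun x => √(s x), fun i => (hk i).toLp, hw, fun x => Real.sqrt_pos.2 (hs1 x),
    fun i => ?_⟩
  filter_upwards [(hk i).coeFn_toLp] with x hx
  rw [hx, div_mul_cancel₀ _ (Real.sqrt_pos.2 (hs1 x)).ne']

/-- The values of the vector measure on subsets of `E` fill out the image of the whole order
interval `[0, w χ_E]`: each nonempty fibre has an extreme point, which is some `w χ_B`. -/
theorem image_condExpVectorMeasure_traceSets [IsFiniteMeasure μ] (hC : C ≤ mA)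
    (hcoarse : IsMuCoarser C μ) {n : ℕ} {k : Fin n → Lp ℝ 2 μ} {f : Fin n → Lp ℝ 1 μ} {w : Ω → ℝ}
    (hw : MemLp w 2 μ) (hw0 : ∀ x, 0 < w x) (hkf : ∀ i, ∀ᵐ x ∂μ, k i x * w x = f i x)
    {E : Set Ω} (hE : MeasurableSet E) :
    condExpVectorMeasure hC f '' traceSets mA E =
      weightedCondExpCLM hC k '' Set.Icc 0 (hw.indicator hE).toLp := by
  have hwE := (hw.indicator hE).coeFn_toLp
  ext y
  constructor
  · rintro ⟨_, ⟨A, hA, rfl⟩, rfl⟩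
    have hB := (hw.indicator (hA.inter hE)).coeFn_toLp
    refine ⟨(hw.indicator (hA.inter hE)).toLp, ⟨(Lp.coeFn_nonneg _).1 ?_, (Lp.coeFn_le _ _).1 ?_⟩,
      weightedCondExpCLM_eq_condExpVectorMeasure hC hkf (hA.inter hE) hB⟩
    · filter_upwards [hB] with x h1
      rw [h1]
      exact Set.indicator_nonneg (fun x _ => (hw0 x).le) x
    · filter_upwards [hB, hwE] with x h1 h2
      rw [h1, h2]
      exact Set.indicator_le_indicator_of_subset Set.inter_subset_right
        (fun x => (hw0 x).le) x
  · rintro ⟨u, hu, rfl⟩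
    set T := weightedCondExpCLM hC k
    set W : Lp ℝ 2 μ := (hw.indicator hE).toLp
    obtain ⟨v, hv⟩ := extremePoints_nonempty_of_isClosed
      (K := Set.Icc 0 W ∩ T ⁻¹' {T u})
      ((convex_Icc_Lp_two 0 W).inter
        ((convex_singleton (T u)).linear_preimage T.toLinearMap))
      (isClosed_Icc.inter (isClosed_singleton.preimage T.continuous))
      ((isBounded_Icc_zero_Lp_two W).subset Set.inter_subset_left) ⟨u, hu, rfl⟩
    have hA : MeasurableSet {x | v x ≠ 0} :=
      (Lp.stronglyMeasurable v).measurable (measurableSet_singleton 0).compl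
    refine ⟨{x | v x ≠ 0} ∩ E, ⟨_, hA, rfl⟩, ?_⟩
    rw [← weightedCondExpCLM_eq_condExpVectorMeasure hC hkf (hA.inter hE) (u := v)]
    · exact hv.1.2
    · filter_upwards [ae_eq_zero_or_eq_of_mem_extremePoints hC hcoarse k W _ hv, hwE]
        with x h1 h2
      by_cases hx : v x = 0
      · simp [hx]
      · have h3 := (h1.resolve_left hx).trans h2
        have hxE : x ∈ E := Set.mem_of_indicator_ne_zero (h3 ▸ hx)
        rw [h3, Set.indicator_of_mem hxE,
          Set.indicator_of_mem (show x ∈ {x | v x ≠ 0} ∩ E from ⟨hx, hxE⟩)]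

end WeightedCondExp

theorem theorem1 {Ω : Type*} (C : MeasurableSpace Ω) [mA : MeasurableSpace Ω]
    (μ : Measure Ω) [IsProbabilityMeasure μ] (hC : C ≤ mA) (hcoarse : IsMuCoarser C μ)
    (n : ℕ) (hn : 1 ≤ n) (f : Fin n → Lp ℝ 1 μ) :
    IsLyapunov (condExpVectorMeasure hC f) := by
  intro E hE
  obtain ⟨w, k, hw, hw0, hkf⟩ := exists_common_memLp_two_factor f
  rw [image_condExpVectorMeasure_traceSets hC hcoarse hw hw0 hkf hE]
  refine ⟨(convex_Icc_Lp_two _ _).linear_image (weightedCondExpCLM hC k).toLinearMap, ?_⟩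
  have h := (isCompact_toWeakSpace_image (convex_Icc_Lp_two 0 (hw.indicator hE).toLp)
    isClosed_Icc (isBounded_Icc_zero_Lp_two _)).image
      (WeakSpace.map (weightedCondExpCLM hC k)).continuous
  rw [Set.image_image] at h ⊢
  exact h
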